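/- Let $\alpha,\beta,\gamma>0$ and let $$F_{\alpha,\beta}^{(\gamma)}(z)=\sum_{k=0}^{\infty}\frac{z^k}{[\Gamma(\alpha k+\beta)]^{\gamma}},\qquad z\in\mathbb{C},$$ be the Le Roy type-function. For $z\in\mathbb{C}\setminus\{0\}$ let $$\mathcal{F}_{-\alpha,\beta}^{(\gamma)}(z)=\frac{1}{2\pi i}\int_{\mathcal{L}_{-\infty}}\frac{\Gamma(-s)\,\Gamma(1+s)}{[\Gamma(-\alpha s+\beta)]^{\gamma}}\,(-z)^{s}\,ds ,$$ where * $\mathcal{L}_{-\infty}$ is a loop that comes from $-\infty+i\varphi_1$ along a horizontal ray, continues along a piecewise $C^1$ arc, and goes to $-\infty+i\varphi_2$ along a horizontal ray, with $\varphi_1<0<\varphi_2$, and that meets the real line only at a point $c$ with $-1<c<0$; * $[\Gamma(-\alpha s+\beta)]^{\gamma}=\exp(\gamma\log\Gamma(-\alpha s+\beta))$ is the holomorphic branch in the $s$-plane cut along $[\beta/\alpha,+\infty)$ that is positive for all negative $s$; * $(-z)^s=\exp\{s(\log|z|+i\arg(-z))\}$, where $\arg(-z)$ is any value of $\operatorname{Arg}(-z)$.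 Then, for every $z\in\mathbb{C}\setminus\{0\}$, every such loop and every choice of $\arg(-z)$, the integral converges absolutely, the series for $F_{\alpha,\beta}^{(\gamma)}(1/z)$ converges, and $$\mathcal{F}_{-\alpha,\beta}^{(\gamma)}(z)=\frac{1}{[\Gamma(\beta)]^{\gamma}}-F_{\alpha,\beta}^{(\gamma)}\!\left(\frac1z\right).$$ -/

import Mathlib

open MeasureTheory

noncomputable section

namespace LeRoy

/-- The Le Roy type-function `F_{α,β}^{(γ)}(z) = ∑_{k ≥ 0} z ^ k / Γ(α k + β) ^ γ`
for real parameters. -/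
def leRoy (α β γ : ℝ) (z : ℂ) : ℂ :=
  ∑' k : ℕ, z ^ k / (((Real.Gamma (α * k + β)) ^ γ : ℝ) : ℂ)

/-- The logarithm of the Gamma function on the plane cut along `(-∞, 0]`, as the integral of
`Γ' / Γ` along the segment from `1` to `w`. It is holomorphic on the cut plane
(`differentiableOn_logGamma`), satisfies `exp (logGamma w) = Γ(w)` there (`exp_logGamma`), and is
real on the positive half-line (`logGamma_ofReal`). -/
def logGamma (w : ℂ) : ℂ :=
  ∫ t in (0 : ℝ)..1, (w - 1) * Complex.digamma (1 + t * (w - 1))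

/-- The branch of `[Γ(-α s + β)] ^ γ` in the complex `s`-plane cut along `[β / α, +∞)` that is
positive for negative `s`. -/
def gammaPow (α β γ : ℝ) (s : ℂ) : ℂ :=
  Complex.exp (γ * logGamma (-α * s + β))

/-- The power `(-z) ^ s = exp (s (log |z| + i θ))`, where `θ` is a value of `Arg (-z)`. -/
def negPow (z : ℂ) (θ : ℝ) (s : ℂ) : ℂ :=
  Complex.exp (s * (Real.log ‖z‖ + Complex.I * θ))

/-- The integrand `Γ(-s) Γ(1 + s) (-z) ^ s / [Γ(-α s + β)] ^ γ`. -/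
def integrand (α β γ : ℝ) (z : ℂ) (θ : ℝ) (s : ℂ) : ℂ :=
  Complex.Gamma (-s) * Complex.Gamma (1 + s) / gammaPow α β γ s * negPow z θ s

/-- A loop `𝓛_{-∞}`: it comes from `-∞ + i φ₁` along a horizontal ray to the point `x₁ + i φ₁`,
follows a piecewise `C¹` arc (parametrized by `[0, 1]`) to `x₂ + i φ₂`, and goes along a horizontal
ray to `-∞ + i φ₂`, where `φ₁ < 0 < φ₂`. The real line is crossed only at the point
`c ∈ (-1, 0)`. (By compactness of the arc, the loop lies in a horizontal strip.) -/
structure LeftLoop where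
  φ₁ : ℝ
  φ₂ : ℝ
  x₁ : ℝ
  x₂ : ℝ
  c : ℝ
  arc : Path (⟨x₁, φ₁⟩ : ℂ) (⟨x₂, φ₂⟩ : ℂ)
  φ₁_neg : φ₁ < 0
  φ₂_pos : 0 < φ₂
  c_mem : c ∈ Set.Ioo (-1 : ℝ) 0
  piecewise_C1 : ∃ S : Finset ℝ, ∀ u v : ℝ, 0 ≤ u → u < v → v ≤ 1 →
    (∀ p ∈ S, p ∉ Set.Ioo u v) → ContDiffOn ℝ 1 arc.extend (Set.Icc u v)
  eq_c_of_im_eq_zero : ∀ t, (arc t).im = 0 → arc t = (c : ℂ)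

namespace LeftLoop

/-- The differential form `f(s) ds`. -/
def form (f : ℂ → ℂ) (s : ℂ) : ℂ →L[ℂ] ℂ :=
  ContinuousLinearMap.toSpanSingleton ℂ (f s)

/-- The contour integral of `f` over the loop converges (absolutely). -/
def ContourIntegrable (L : LeftLoop) (f : ℂ → ℂ) : Prop :=
  IntegrableOn (fun x : ℝ => f ⟨x, L.φ₁⟩) (Set.Iic L.x₁) ∧
  CurveIntegrable (form f) L.arc ∧
  IntegrableOn (fun x : ℝ => f ⟨x, L.φ₂⟩) (Set.Iic L.x₂)

/-- The contour integral `∫_L f(s) ds`, the loop being run through from `-∞ + i φ₁` to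
`-∞ + i φ₂`. -/
def contourIntegral (L : LeftLoop) (f : ℂ → ℂ) : ℂ :=
  (∫ x in Set.Iic L.x₁, f ⟨x, L.φ₁⟩) + curveIntegral (form f) L.arc
    - ∫ x in Set.Iic L.x₂, f ⟨x, L.φ₂⟩

end LeftLoop

/-- The extended Le Roy type-function `𝓕_{-α,β}^{(γ)}(z)`, computed with the loop `L` and the
value `θ` of `Arg (-z)`:
`(2 π i)⁻¹ ∫_L Γ(-s) Γ(1 + s) (-z) ^ s / [Γ(-α s + β)] ^ γ ds`. -/
def leRoyExt (α β γ : ℝ) (L : LeftLoop) (θ : ℝ) (z : ℂ) : ℂ :=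
  (2 * Real.pi * Complex.I)⁻¹ * L.contourIntegral (integrand α β γ z θ)

/-! Checks that `logGamma` and `gammaPow` are the branches described above. -/

lemma seg_mem {w : ℂ} (hw : w ∈ Complex.slitPlane) {t : ℝ} (ht : t ∈ Set.Icc (0 : ℝ) 1) :
    1 + (t : ℂ) * (w - 1) ∈ Complex.slitPlane := by
  have := Complex.starConvex_one_slitPlane hw (a := 1 - t) (b := t) (by linarith [ht.2]) ht.1
    (by ring)
  convert this using 1
  simp only [Complex.real_smul, Complex.ofReal_sub, Complex.ofReal_one]
  ring

lemma ne_neg_nat {w : ℂ} (hw : w ∈ Complex.slitPlane) (m : ℕ) : w ≠ -m := by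
  rintro rfl
  rcases hw with h | h
  · have : (0 : ℝ) ≤ m := Nat.cast_nonneg m
    simp at h
    linarith
  · simp at h

lemma differentiableOn_digamma : DifferentiableOn ℂ Complex.digamma Complex.slitPlane := by
  have hG : DifferentiableOn ℂ Complex.Gamma Complex.slitPlane := fun w hw =>
    (Complex.differentiableAt_Gamma w (ne_neg_nat hw)).differentiableWithinAt
  exact (hG.deriv Complex.isOpen_slitPlane).div hG fun w hw =>
    Complex.Gamma_ne_zero (ne_neg_nat hw)

lemma exp_logGamma {w : ℂ} (hw : w ∈ Complex.slitPlane) :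
    Complex.exp (logGamma w) = Complex.Gamma w := by
  have hm : ∀ t ∈ Set.Icc (0 : ℝ) 1, 1 + (t : ℂ) * (w - 1) ∈ Complex.slitPlane :=
    fun t ht => seg_mem hw ht
  have hℓ : ∀ t : ℝ, HasDerivAt (fun t : ℝ => 1 + (t : ℂ) * (w - 1)) (w - 1) t := fun t => by
    simpa using ((Complex.ofRealCLM.hasDerivAt (x := t)).mul_const (w - 1)).const_add 1
  have hU : IsOpen {t : ℝ | 1 + (t : ℂ) * (w - 1) ∈ Complex.slitPlane} :=
    Complex.isOpen_slitPlane.preimage (by fun_prop)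
  have hcont : ∀ t ∈ {t : ℝ | 1 + (t : ℂ) * (w - 1) ∈ Complex.slitPlane},
      ContinuousAt (fun t : ℝ => (w - 1) * Complex.digamma (1 + t * (w - 1))) t := fun t ht => by
    have h1 : ContinuousAt Complex.digamma (1 + (t : ℂ) * (w - 1)) :=
      (differentiableOn_digamma.differentiableAt
        (Complex.isOpen_slitPlane.mem_nhds ht)).continuousAt
    exact continuousAt_const.mul
      (ContinuousAt.comp (f := fun t : ℝ => 1 + (t : ℂ) * (w - 1)) h1 (hℓ t).continuousAt)
  have hint : ∀ t ∈ Set.Icc (0 : ℝ) 1, HasDerivAt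
      (fun u : ℝ => ∫ t in (0 : ℝ)..u, (w - 1) * Complex.digamma (1 + t * (w - 1)))
      ((w - 1) * Complex.digamma (1 + t * (w - 1))) t := fun t ht => by
    refine intervalIntegral.integral_hasDerivAt_right ?_ ?_ (hcont t (hm t ht))
    · refine ContinuousOn.intervalIntegrable fun u hu => (hcont u (hm u ?_)).continuousWithinAt
      rw [Set.uIcc_of_le ht.1] at hu
      exact ⟨hu.1, hu.2.trans ht.2⟩
    · exact (ContinuousOn.stronglyMeasurableAtFilter hU
        (fun u hu => (hcont u hu).continuousWithinAt)) t (hm t ht)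
  set P : ℝ → ℂ := fun u => ∫ t in (0 : ℝ)..u, (w - 1) * Complex.digamma (1 + t * (w - 1)) with hP
  have hd : ∀ t ∈ Set.Icc (0 : ℝ) 1, HasDerivAt
      (fun t : ℝ => Complex.exp (-P t) * Complex.Gamma (1 + t * (w - 1))) 0 t := fun t ht => by
    have hG := (Complex.differentiableAt_Gamma _ (ne_neg_nat (hm t ht))).hasDerivAt
    have h1 := (hint t ht).neg.cexp.mul
      (HasDerivAt.comp (h := fun t : ℝ => 1 + (t : ℂ) * (w - 1)) t hG (hℓ t))
    refine h1.congr_deriv ?_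
    have h0 := Complex.Gamma_ne_zero (ne_neg_nat (hm t ht))
    simp only [Complex.digamma, logDeriv_apply, Function.comp]
    have h2 : deriv Complex.Gamma (1 + t * (w - 1)) =
        deriv Complex.Gamma (1 + t * (w - 1)) / Complex.Gamma (1 + t * (w - 1)) *
          Complex.Gamma (1 + t * (w - 1)) := (div_mul_cancel₀ _ h0).symm
    simp only [Pi.neg_apply]
    linear_combination Complex.exp (-P t) * (w - 1) * h2
  have hc := constant_of_has_deriv_right_zero
    (fun t ht => (hd t ht).continuousAt.continuousWithinAt)
    (fun t ht => (hd t ⟨ht.1, ht.2.le⟩).hasDerivWithinAt) 1 (by simp)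
  have hP0 : P 0 = 0 := by simp [hP]
  have hP1 : P 1 = logGamma w := rfl
  simp only [hP0, hP1, Complex.ofReal_one, Complex.ofReal_zero, one_mul, zero_mul, add_zero,
    neg_zero, Complex.exp_zero, Complex.Gamma_one, add_sub_cancel] at hc
  rw [Complex.exp_neg] at hc
  field_simp at hc
  exact hc.symm

lemma continuousOn_logGamma : ContinuousOn logGamma Complex.slitPlane := by
  rw [continuousOn_iff_continuous_domRestrict]
  have hc : Continuous (Function.uncurry fun (w : Complex.slitPlane) (t : ℝ) =>
      ((w : ℂ) - 1) * Complex.digamma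
        (1 + ((Set.projIcc (0 : ℝ) 1 zero_le_one t : ℝ) : ℂ) * ((w : ℂ) - 1))) := by
    refine Continuous.mul (by fun_prop) ?_
    refine differentiableOn_digamma.continuousOn.comp_continuous ?_ fun p =>
      seg_mem p.1.2 (Set.projIcc (0 : ℝ) 1 zero_le_one p.2).2
    have : Continuous (Set.projIcc (0 : ℝ) 1 zero_le_one) := continuous_projIcc
    fun_prop
  refine (intervalIntegral.continuous_parametric_intervalIntegral_of_continuous' (μ := volume)
    hc 0 1).congr
    fun w => ?_
  refine intervalIntegral.integral_congr fun t ht => ?_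
  rw [Set.uIcc_of_le zero_le_one] at ht
  simp only [Set.projIcc_of_mem zero_le_one ht]

lemma differentiableOn_logGamma : DifferentiableOn ℂ logGamma Complex.slitPlane := by
  intro w hw
  have hn := Complex.isOpen_slitPlane.mem_nhds hw
  have hG0 := Complex.Gamma_ne_zero (ne_neg_nat hw)
  have hcont : ContinuousAt (fun u => (logGamma u - logGamma w).im) w :=
    Complex.continuous_im.continuousAt.comp
      ((continuousOn_logGamma.continuousAt hn).sub continuousAt_const)
  have hev : ∀ᶠ u in nhds w, (logGamma u - logGamma w).im ∈ Set.Ioo (-Real.pi) Real.pi :=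
    hcont.eventually_mem (Ioo_mem_nhds (by simp [Real.pi_pos]) (by simp [Real.pi_pos]))
  have heq : logGamma =ᶠ[nhds w] fun u =>
      Complex.log (Complex.Gamma u / Complex.Gamma w) + logGamma w := by
    filter_upwards [hev, hn] with u hu hus
    rw [← exp_logGamma hus, ← exp_logGamma hw, ← Complex.exp_sub,
      Complex.log_exp hu.1 hu.2.le, sub_add_cancel]
  refine DifferentiableAt.differentiableWithinAt (DifferentiableAt.congr_of_eventuallyEq ?_ heq)
  refine DifferentiableAt.add_const _ (DifferentiableAt.clog
    ((Complex.differentiableAt_Gamma w (ne_neg_nat hw)).div_const _) ?_)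
  rw [div_self hG0]
  exact Complex.one_mem_slitPlane

lemma digamma_ofReal {x : ℝ} (hx : 0 < x) :
    Complex.digamma x = ((deriv Real.Gamma x / Real.Gamma x : ℝ) : ℂ) := by
  have hs : (x : ℂ) ∈ Complex.slitPlane := Complex.ofReal_mem_slitPlane.2 hx
  have h1 := (Complex.differentiableAt_Gamma _ (ne_neg_nat hs)).hasDerivAt.comp_ofReal
  have h2 := (Real.differentiableAt_Gamma (s := x) fun m h => by
    have : (0 : ℝ) ≤ m := Nat.cast_nonneg m
    linarith).hasDerivAt.ofReal_comp
  have h3 := h1.unique (h2.congr_of_eventuallyEq (Filter.Eventually.of_forall fun y => by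
    simp [Complex.Gamma_ofReal]))
  rw [Complex.digamma, logDeriv_apply, h3, Complex.Gamma_ofReal, Complex.ofReal_div]

lemma logGamma_ofReal {x : ℝ} (hx : 0 < x) : logGamma x = Real.log (Real.Gamma x) := by
  have hs : (x : ℂ) ∈ Complex.slitPlane := Complex.ofReal_mem_slitPlane.2 hx
  obtain ⟨r, hr⟩ : ∃ r : ℝ, logGamma x = r := by
    refine ⟨∫ t in (0 : ℝ)..1, (x - 1) *
      (deriv Real.Gamma (1 + t * (x - 1)) / Real.Gamma (1 + t * (x - 1))), ?_⟩
    rw [logGamma, ← intervalIntegral.integral_ofReal]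
    refine intervalIntegral.integral_congr fun t ht => ?_
    rw [Set.uIcc_of_le zero_le_one] at ht
    have hp : 0 < 1 + t * (x - 1) := by
      have := seg_mem hs ht
      rw [← Complex.ofReal_mem_slitPlane]
      push_cast
      exact this
    have := digamma_ofReal hp
    push_cast at this ⊢
    rw [this]
  have h := exp_logGamma hs
  rw [hr, Complex.Gamma_ofReal, ← Complex.ofReal_exp] at h
  rw [hr, ← Complex.ofReal_inj.1 h, Real.log_exp]

lemma gammaPow_ofReal {α β γ x : ℝ} (hx : 0 < -α * x + β) :
    gammaPow α β γ x = ((Real.Gamma (-α * x + β)) ^ γ : ℝ) := by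
  have h := logGamma_ofReal hx
  push_cast at h
  rw [gammaPow, h, Real.rpow_def_of_pos (Real.Gamma_pos_of_pos hx)]
  push_cast
  rw [mul_comm]

end LeRoy

end

/-!
Since `Γ(-s) Γ(1 + s) = -π / sin (π s)`, the integrand is `-π / sin (π s)` times
`G(s) = (-z) ^ s / [Γ(-α s + β)] ^ γ`, which is holomorphic off the cut `[β / α, ∞)`. To the left of
the cut it has simple poles at the negative integers only, and its residue at `-k` is
`-(1 / z) ^ k / Γ(α k + β) ^ γ`. The identity is the residue theorem for a loop that encircles
exactly the poles `-1, -2, …`; the term `k = 0` of the series of `F(1 / z)` is missing from the sum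
of the residues, which accounts for `1 / Γ(β) ^ γ`.

* Convergence. In a horizontal half-strip `|Γ(w)|` exceeds every exponential of `Re w`
  (`exists_mul_exp_le_norm_Gamma`): it is bounded below on a compact rectangle, and the functional
  equation turns this bound into a factorial one. Hence `|G(s)| ≤ M exp (Re s)` in left half-strips
  (`LeRoy.exists_norm_regularPart_le`). At `s = -k` this gives the summability of the series, on
  horizontal lines the convergence of the integral, and on the vertical segments `Re s = -k - 1 / 2`
  the vanishing of the remainder.
* The shape of the loop does not matter. The arc stays in the plane cut along `(-∞, -1]` and
  `[0, ∞)`, where the integrand has a primitive (`isExactOn_of_differentiableAt_off_rays`). So the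
  arc may cross the real axis at its point `c` any number of times, and the loop may be replaced by
  one that crosses the strip along the vertical segment `Re s = -1 / 2`
  (`LeRoy.contourIntegral_eq_hookIntegral`).
* Residues. Moving the crossing from `Re s = -k - 1 / 2` to `Re s = -k - 3 / 2` changes the integral
  by that over the boundary of a rectangle, which Cauchy's formula evaluates
  (`rectIntegral_div_sub`, `LeRoy.rectIntegral_integrand`). Summing over `k` gives
  `LeRoy.hookIntegral_integrand`.
-/

noncomputable section

/-! ### Growth of the Gamma function in horizontal strips -/

lemma exists_mul_pow_le_factorial (C : ℝ) : ∃ K : ℝ, 0 < K ∧ ∀ n : ℕ, K * C ^ n ≤ n.factorial := by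
  obtain ⟨B, hB⟩ := (FloorSemiring.tendsto_pow_div_factorial_atTop C).bddAbove_range
  refine ⟨(|B| + 1)⁻¹, by positivity, fun n => ?_⟩
  have h : C ^ n / n.factorial ≤ B := hB ⟨n, rfl⟩
  have hf : (0 : ℝ) < n.factorial := by exact_mod_cast n.factorial_pos
  rw [div_le_iff₀ hf] at h
  rw [inv_mul_le_iff₀ (by positivity)]
  nlinarith [le_abs_self B]

lemma factorial_mul_norm_Gamma_le {w : ℂ} (hw : 1 ≤ w.re) (n : ℕ) :
    n.factorial * ‖Complex.Gamma w‖ ≤ ‖Complex.Gamma (w + n)‖ := by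
  induction n with
  | zero => simp
  | succ n ih =>
    have hre : (n : ℝ) + 1 ≤ (w + n).re := by simp; linarith
    have h0 : w + n ≠ 0 := fun h => by
      rw [h, Complex.zero_re] at hre
      linarith [(Nat.cast_nonneg n : (0 : ℝ) ≤ n)]
    have hn : (n : ℝ) + 1 ≤ ‖w + n‖ := hre.trans (Complex.re_le_norm _)
    have : w + ((n + 1 : ℕ) : ℂ) = w + n + 1 := by push_cast; ring
    rw [this, Complex.Gamma_add_one _ h0, norm_mul, Nat.factorial_succ]
    push_cast
    rw [mul_assoc]
    exact mul_le_mul hn ih (by positivity) (by positivity)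

/-- The Gamma function grows faster than any exponential in every horizontal half-strip: its
values on a compact fundamental rectangle are bounded away from `0`, and the functional equation
multiplies them by at least a factorial. -/
lemma exists_mul_exp_le_norm_Gamma_of_one_le (C Y : ℝ) : ∃ K : ℝ, 0 < K ∧ ∀ w : ℂ, 1 ≤ w.re →
    |w.im| ≤ Y → K * Real.exp (C * w.re) ≤ ‖Complex.Gamma w‖ := by
  obtain ⟨B, hB⟩ := (isCompact_Icc.reProdIm isCompact_Icc :
    IsCompact (Set.Icc (1 : ℝ) 2 ×ℂ Set.Icc (-Y) Y)).exists_bound_of_continuousOn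
      Complex.differentiable_one_div_Gamma.continuous.continuousOn
  obtain ⟨K, hK, hKn⟩ := exists_mul_pow_le_factorial (Real.exp C)
  refine ⟨K * Real.exp (-(2 * |C|)) * (|B| + 1)⁻¹, by positivity, fun w hw hY => ?_⟩
  set n := ⌊w.re - 1⌋₊ with hn
  have h1 : (n : ℝ) ≤ w.re - 1 := Nat.floor_le (by linarith)
  have h2 : w.re - 1 < n + 1 := Nat.lt_floor_add_one _
  set v : ℂ := w - n with hv
  have hvre : v.re = w.re - n := by simp [hv]
  have hvim : v.im = w.im := by simp [hv]
  have hG0 : 0 < ‖Complex.Gamma v‖ :=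
    norm_pos_iff.2 (Complex.Gamma_ne_zero_of_re_pos (by rw [hvre]; linarith))
  have hvB := hB v (by
    rw [Complex.mem_reProdIm, hvre, hvim]
    exact ⟨⟨by linarith, by linarith⟩, abs_le.1 hY⟩)
  rw [norm_inv] at hvB
  have hvG : (|B| + 1)⁻¹ ≤ ‖Complex.Gamma v‖ :=
    inv_le_of_inv_le₀ hG0 (by linarith [le_abs_self B])
  have hfac := factorial_mul_norm_Gamma_le (w := v) (by rw [hvre]; linarith) n
  rw [show v + n = w by simp [hv]] at hfac
  have hexp : Real.exp (C * w.re) ≤ Real.exp (2 * |C|) * Real.exp C ^ n := by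
    rw [← Real.exp_nat_mul, ← Real.exp_add]
    refine Real.exp_le_exp.2 ?_
    have : C * w.re = C * v.re + n * C := by rw [hvre]; ring
    rw [this]
    have h3 : C * v.re ≤ |C| * v.re :=
      mul_le_mul_of_nonneg_right (le_abs_self C) (by rw [hvre]; linarith)
    have h4 : |C| * v.re ≤ |C| * 2 :=
      mul_le_mul_of_nonneg_left (by rw [hvre]; linarith) (abs_nonneg C)
    linarith
  calc K * Real.exp (-(2 * |C|)) * (|B| + 1)⁻¹ * Real.exp (C * w.re)
      ≤ K * Real.exp (-(2 * |C|)) * (|B| + 1)⁻¹ * (Real.exp (2 * |C|) * Real.exp C ^ n) := by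
        gcongr
    _ = K * Real.exp C ^ n * (|B| + 1)⁻¹ := by
        have : Real.exp (-(2 * |C|)) * Real.exp (2 * |C|) = 1 := by
          rw [← Real.exp_add]; simp
        linear_combination (K * (|B| + 1)⁻¹ * Real.exp C ^ n) * this
    _ ≤ n.factorial * ‖Complex.Gamma v‖ := by
        gcongr
        exact hKn n
    _ ≤ ‖Complex.Gamma w‖ := hfac

lemma exists_mul_exp_le_norm_Gamma (C Y : ℝ) : ∃ K : ℝ, 0 < K ∧ ∀ w : ℂ, 0 < w.re →
    |w.im| ≤ Y → K * Real.exp (C * w.re) ≤ ‖Complex.Gamma w‖ := by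
  obtain ⟨K, hK, h⟩ := exists_mul_exp_le_norm_Gamma_of_one_le (C + 1) Y
  refine ⟨K * Real.exp (C + 1) * Real.exp (-Y), by positivity, fun w hw hY => ?_⟩
  have h0 : w ≠ 0 := fun h => by simp [h] at hw
  have h1 := h (w + 1) (by simp; linarith) (by simpa using hY)
  rw [Complex.Gamma_add_one _ h0, norm_mul] at h1
  -- the factor `w` of the functional equation is absorbed by one more exponential
  have h2 : ‖w‖ ≤ Real.exp (w.re + Y) := by
    have := Complex.norm_le_abs_re_add_abs_im w
    rw [abs_of_pos hw] at this
    linarith [Real.add_one_le_exp (w.re + Y)]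
  have h3 : K * Real.exp ((C + 1) * (w + 1).re) ≤
      Real.exp (w.re + Y) * ‖Complex.Gamma w‖ :=
    h1.trans (mul_le_mul_of_nonneg_right h2 (norm_nonneg _))
  have h4 : K * Real.exp (C + 1) * Real.exp (-Y) * Real.exp (C * w.re) =
      Real.exp (-(w.re + Y)) * (K * Real.exp ((C + 1) * (w + 1).re)) := by
    rw [mul_left_comm, mul_assoc, mul_assoc, ← Real.exp_add, ← Real.exp_add, ← Real.exp_add]
    congr 2
    simp
    ring
  rw [h4]
  calc _ ≤ Real.exp (-(w.re + Y)) * (Real.exp (w.re + Y) * ‖Complex.Gamma w‖) := by gcongr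
    _ = ‖Complex.Gamma w‖ := by rw [← mul_assoc, ← Real.exp_add]; simp

/-! ### The integrand -/

namespace LeRoy

/-- The factor `(-z) ^ s / [Γ(-α s + β)] ^ γ` of the integrand. -/
def regularPart (α β γ : ℝ) (z : ℂ) (θ : ℝ) (s : ℂ) : ℂ :=
  negPow z θ s / gammaPow α β γ s

lemma integrand_eq (α β γ : ℝ) (z : ℂ) (θ : ℝ) (s : ℂ) :
    integrand α β γ z θ s = -(Real.pi / Complex.sin (Real.pi * s)) * regularPart α β γ z θ s := by
  have h := Complex.Gamma_mul_Gamma_one_sub (-s)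
  rw [sub_neg_eq_add, mul_neg, Complex.sin_neg, div_neg] at h
  rw [integrand, regularPart, h]
  ring

lemma norm_gammaPow {α β γ : ℝ} {s : ℂ} (hs : -α * s + β ∈ Complex.slitPlane) :
    ‖gammaPow α β γ s‖ = ‖Complex.Gamma (-α * s + β)‖ ^ γ := by
  rw [← exp_logGamma hs, gammaPow, Complex.norm_exp, Complex.norm_exp, Complex.re_ofReal_mul,
    mul_comm, Real.exp_mul]

lemma norm_negPow (z : ℂ) (θ : ℝ) (s : ℂ) :
    ‖negPow z θ s‖ = Real.exp (s.re * Real.log ‖z‖ - s.im * θ) := by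
  rw [negPow, Complex.norm_exp]
  simp

lemma gammaArg_mem_slitPlane {α β : ℝ} (hα : 0 < α) (hβ : 0 < β) {s : ℂ}
    (hs : s.im ≠ 0 ∨ s.re < 0) : -α * s + β ∈ Complex.slitPlane := by
  rw [Complex.mem_slitPlane_iff]
  rcases hs with hs | hs
  · right
    simp [hs, hα.ne']
  · left
    simp
    nlinarith

lemma differentiableAt_regularPart {α β γ : ℝ} (hα : 0 < α) (hβ : 0 < β) (z : ℂ) (θ : ℝ) {s : ℂ}
    (hs : s.im ≠ 0 ∨ s.re < 0) : DifferentiableAt ℂ (regularPart α β γ z θ) s := by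
  have h1 : DifferentiableAt ℂ logGamma (-α * s + β) :=
    differentiableOn_logGamma.differentiableAt
      (Complex.isOpen_slitPlane.mem_nhds (gammaArg_mem_slitPlane hα hβ hs))
  have h2 : DifferentiableAt ℂ (fun s : ℂ => logGamma (-α * s + β)) s :=
    DifferentiableAt.comp (f := fun s : ℂ => -α * s + β) s h1 (by fun_prop)
  refine DifferentiableAt.div ?_ ((h2.const_mul _).cexp) (Complex.exp_ne_zero _)
  unfold negPow
  fun_prop

/-- In a left half-strip `1 / [Γ(-α s + β)] ^ γ` decays faster than every exponential, so it
overcomes the factor `(-z) ^ s` with room to spare. -/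
lemma exists_norm_regularPart_le {α β γ : ℝ} (hα : 0 < α) (hβ : 0 < β) (hγ : 0 < γ)
    (z : ℂ) (θ Y : ℝ) : ∃ M : ℝ, 0 < M ∧ ∀ s : ℂ, s.re < 0 → |s.im| ≤ Y →
      ‖regularPart α β γ z θ s‖ ≤ M * Real.exp s.re := by
  set l := Real.log ‖z‖ with hl
  set C := (|l| + 1) / (γ * α) with hC
  obtain ⟨K, hK, h⟩ := exists_mul_exp_le_norm_Gamma C (α * Y)
  refine ⟨(K ^ γ)⁻¹ * Real.exp (Y * |θ|), by positivity, fun s hs hY => ?_⟩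
  have hre : (-α * s + β : ℂ).re = -α * s.re + β := by simp
  have him : (-α * s + β : ℂ).im = -α * s.im := by simp
  have h1 := h (-α * s + β) (by rw [hre]; nlinarith)
    (by rw [him, abs_mul, abs_neg, abs_of_pos hα]; gcongr)
  have h2 : K ^ γ * Real.exp (-(|l| + 1) * s.re) ≤ ‖gammaPow α β γ s‖ := by
    rw [norm_gammaPow (gammaArg_mem_slitPlane hα hβ (Or.inr hs))]
    refine le_trans ?_ (Real.rpow_le_rpow (by positivity) h1 hγ.le)
    rw [Real.mul_rpow hK.le (Real.exp_pos _).le, ← Real.exp_mul, hre]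
    refine mul_le_mul_of_nonneg_left (Real.exp_le_exp.2 ?_) (by positivity)
    have h3 : C * (-α * s.re + β) * γ = -(|l| + 1) * s.re + C * β * γ := by
      rw [hC]; field_simp
    rw [h3]
    have : 0 < C * β * γ := by positivity
    linarith
  have h3 : ‖negPow z θ s‖ ≤ Real.exp (s.re * l + Y * |θ|) := by
    rw [norm_negPow]
    refine Real.exp_le_exp.2 ?_
    have : -(s.im * θ) ≤ |s.im| * |θ| := by rw [← abs_mul]; exact neg_le_abs _
    have : |s.im| * |θ| ≤ Y * |θ| := mul_le_mul_of_nonneg_right hY (abs_nonneg θ)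
    linarith
  rw [regularPart, norm_div]
  calc ‖negPow z θ s‖ / ‖gammaPow α β γ s‖
      ≤ Real.exp (s.re * l + Y * |θ|) / (K ^ γ * Real.exp (-(|l| + 1) * s.re)) := by gcongr
    _ = (K ^ γ)⁻¹ * Real.exp (Y * |θ|) * Real.exp (s.re * (l + |l|) + s.re) := by
        rw [div_eq_mul_inv, mul_inv, ← Real.exp_neg, mul_left_comm, mul_assoc, ← Real.exp_add,
          ← Real.exp_add]
        ring_nf
    _ ≤ (K ^ γ)⁻¹ * Real.exp (Y * |θ|) * Real.exp s.re := by
        gcongr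
        have : 0 ≤ l + |l| := by linarith [neg_abs_le l]
        nlinarith

lemma sq_norm_sin (s : ℂ) : ‖Complex.sin s‖ ^ 2 = Real.sin s.re ^ 2 + Real.sinh s.im ^ 2 := by
  have h : Complex.sin s = ⟨Real.sin s.re * Real.cosh s.im, Real.cos s.re * Real.sinh s.im⟩ := by
    rw [Complex.sin_eq, ← Complex.ofReal_sin, ← Complex.ofReal_cos, ← Complex.ofReal_cosh,
      ← Complex.ofReal_sinh, Complex.mk_eq_add_mul_I]
    push_cast
    ring
  rw [Complex.sq_norm, h, Complex.normSq_mk]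
  have h1 := Real.cosh_sq s.im
  have h2 := Real.sin_sq_add_cos_sq s.re
  linear_combination Real.sin s.re ^ 2 * h1 + Real.sinh s.im ^ 2 * h2

lemma abs_sinh_le_norm_sin (s : ℂ) : |Real.sinh s.im| ≤ ‖Complex.sin s‖ := by
  rw [← Real.sqrt_sq_eq_abs, ← Real.sqrt_sq (norm_nonneg (Complex.sin s)), sq_norm_sin]
  exact Real.sqrt_le_sqrt (by nlinarith [sq_nonneg (Real.sin s.re)])

lemma abs_sin_le_norm_sin (s : ℂ) : |Real.sin s.re| ≤ ‖Complex.sin s‖ := by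
  rw [← Real.sqrt_sq_eq_abs, ← Real.sqrt_sq (norm_nonneg (Complex.sin s)), sq_norm_sin]
  exact Real.sqrt_le_sqrt (by nlinarith [sq_nonneg (Real.sinh s.im)])

lemma sin_pi_mul_ne_zero {s : ℂ} (hs : s.im ≠ 0 ∨ ∃ n : ℤ, (n : ℝ) < s.re ∧ s.re < n + 1) :
    Complex.sin (Real.pi * s) ≠ 0 := by
  intro h
  obtain ⟨m, hm⟩ := Complex.sin_eq_zero_iff.1 h
  have hpi : (Real.pi : ℂ) ≠ 0 := by exact_mod_cast Real.pi_ne_zero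
  have hsm : s = m := mul_left_cancel₀ hpi (by rw [hm]; ring)
  rcases hs with hs | ⟨n, h1, h2⟩
  · exact hs (by simp [hsm])
  · rw [hsm, Complex.intCast_re] at h1 h2
    have h1' : n < m := by exact_mod_cast h1
    have h2' : m < n + 1 := by exact_mod_cast h2
    omega

lemma differentiableAt_integrand {α β γ : ℝ} (hα : 0 < α) (hβ : 0 < β) (z : ℂ) (θ : ℝ) {s : ℂ}
    (hs : s.im ≠ 0 ∨ -1 < s.re ∧ s.re < 0) : DifferentiableAt ℂ (integrand α β γ z θ) s := by
  rw [funext (integrand_eq α β γ z θ)]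
  have h0 : Complex.sin (Real.pi * s) ≠ 0 :=
    sin_pi_mul_ne_zero (hs.imp_right fun h => ⟨-1, by simpa using h⟩)
  have h1 : DifferentiableAt ℂ (fun s : ℂ => Complex.sin (Real.pi * s)) s := by fun_prop
  exact (((differentiableAt_const _).div h1 h0).neg).mul
    (differentiableAt_regularPart hα hβ z θ (hs.imp_right And.right))

lemma exists_norm_integrand_horizontal_le {α β γ : ℝ} (hα : 0 < α) (hβ : 0 < β) (hγ : 0 < γ)
    (z : ℂ) (θ : ℝ) {φ : ℝ} (hφ : φ ≠ 0) : ∃ M : ℝ, ∀ x : ℝ, x < 0 →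
      ‖integrand α β γ z θ ⟨x, φ⟩‖ ≤ M * Real.exp x := by
  obtain ⟨M, hM, h⟩ := exists_norm_regularPart_le hα hβ hγ z θ |φ|
  have hsh : 0 < |Real.sinh (Real.pi * φ)| :=
    abs_pos.2 (Real.sinh_ne_zero.2 (mul_ne_zero Real.pi_ne_zero hφ))
  refine ⟨Real.pi / |Real.sinh (Real.pi * φ)| * M, fun x hx => ?_⟩
  have h1 := abs_sinh_le_norm_sin (Real.pi * ⟨x, φ⟩)
  rw [Complex.im_ofReal_mul] at h1
  rw [integrand_eq, norm_mul, norm_neg, norm_div, Complex.norm_of_nonneg Real.pi_pos.le, mul_assoc]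
  gcongr
  exact h ⟨x, φ⟩ hx le_rfl

lemma exists_norm_integrand_vertical_le {α β γ : ℝ} (hα : 0 < α) (hβ : 0 < β) (hγ : 0 < γ)
    (z : ℂ) (θ Y : ℝ) : ∃ M : ℝ, ∀ (k : ℕ) (y : ℝ), |y| ≤ Y →
      ‖integrand α β γ z θ ⟨-k - 1 / 2, y⟩‖ ≤ M * Real.exp (-k - 1 / 2) := by
  obtain ⟨M, hM, h⟩ := exists_norm_regularPart_le hα hβ hγ z θ Y
  refine ⟨Real.pi * M, fun k y hy => ?_⟩
  have h1 := abs_sin_le_norm_sin (Real.pi * ⟨-k - 1 / 2, y⟩)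
  have h2 : |Real.sin (Real.pi * (-k - 1 / 2))| = 1 := by
    have : Real.pi * (-k - 1 / 2) = -(Real.pi / 2 + k * Real.pi) := by ring
    rw [this, Real.sin_neg, Real.sin_add_nat_mul_pi]
    simp
  rw [Complex.re_ofReal_mul, h2] at h1
  rw [integrand_eq, norm_mul, norm_neg, norm_div, Complex.norm_of_nonneg Real.pi_pos.le, mul_assoc]
  gcongr
  · exact div_le_self Real.pi_pos.le h1
  · exact h ⟨-k - 1 / 2, y⟩ (by simp; linarith [(Nat.cast_nonneg k : (0 : ℝ) ≤ k)]) hy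

end LeRoy

/-! ### Primitives and curve integrals -/

lemma Complex.IsExactOn.union {f : ℂ → ℂ} {U V : Set ℂ} (hfU : Complex.IsExactOn f U)
    (hfV : Complex.IsExactOn f V) (hU : IsOpen U) (hV : IsOpen V)
    (hUV : IsPreconnected (U ∩ V)) (hne : (U ∩ V).Nonempty) : Complex.IsExactOn f (U ∪ V) := by
  classical
  obtain ⟨F, hF⟩ := hfU
  obtain ⟨G, hG⟩ := hfV
  obtain ⟨w, hw⟩ := hne
  have hG' : ∀ z ∈ V, HasDerivAt (fun z => G z + (F w - G w)) (f z) z :=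
    fun z hz => (hG z hz).add_const _
  have heq : Set.EqOn F (fun z => G z + (F w - G w)) (U ∩ V) :=
    (hU.inter hV).eqOn_of_deriv_eq hUV
      (fun z hz => (hF z hz.1).differentiableAt.differentiableWithinAt)
      (fun z hz => (hG' z hz.2).differentiableAt.differentiableWithinAt)
      (fun z hz => by rw [(hF z hz.1).deriv, (hG' z hz.2).deriv]) hw (by ring)
  refine ⟨fun z => if z ∈ U then F z else G z + (F w - G w), fun z hz => ?_⟩
  rcases hz with hz | hz
  · refine (hF z hz).congr_of_eventuallyEq ?_
    filter_upwards [hU.mem_nhds hz] with u hu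
    simp [hu]
  · refine (hG' z hz).congr_of_eventuallyEq ?_
    filter_upwards [hV.mem_nhds hz] with u hu
    by_cases huU : u ∈ U
    · simpa [huU] using heq ⟨huU, hu⟩
    · simp [huU]

lemma DifferentiableOn.isExactOn_of_convex {f : ℂ → ℂ} {U : Set ℂ} (hf : DifferentiableOn ℂ f U)
    (hU : IsOpen U) (hc : Convex ℝ U) : Complex.IsExactOn f U := by
  obtain ⟨g, hg⟩ := hc.exists_forall_hasDerivWithinAt hf
  exact ⟨g, fun z hz => (hg z hz).hasDerivAt (hU.mem_nhds hz)⟩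

/-- A function that is holomorphic off the two real rays `(-∞, a]` and `[b, ∞)` has a primitive
there, although this domain is not convex: it is the union of two half-planes and a vertical
strip. -/
lemma isExactOn_of_differentiableAt_off_rays {f : ℂ → ℂ} {a b : ℝ} (hab : a < b)
    (hf : ∀ s : ℂ, s.im ≠ 0 ∨ a < s.re ∧ s.re < b → DifferentiableAt ℂ f s) :
    Complex.IsExactOn f {s | s.im ≠ 0 ∨ a < s.re ∧ s.re < b} := by
  set S : Set ℂ := {s | a < s.re} ∩ {s | s.re < b} with hS
  set H : Set ℂ := {s | 0 < s.im} with hH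
  set N : Set ℂ := {s | s.im < 0} with hN
  have hSo : IsOpen S := (isOpen_lt continuous_const Complex.continuous_re).inter
    (isOpen_lt Complex.continuous_re continuous_const)
  have hHo : IsOpen H := isOpen_lt continuous_const Complex.continuous_im
  have hNo : IsOpen N := isOpen_lt Complex.continuous_im continuous_const
  have hSc : Convex ℝ S := (convex_halfSpace_re_gt a).inter (convex_halfSpace_re_lt b)
  have hHc : Convex ℝ H := convex_halfSpace_im_gt 0
  have hNc : Convex ℝ N := convex_halfSpace_im_lt 0
  have hSe : Complex.IsExactOn f S := DifferentiableOn.isExactOn_of_convex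
    (fun s hs => (hf s (Or.inr hs)).differentiableWithinAt) hSo hSc
  have hHe : Complex.IsExactOn f H := DifferentiableOn.isExactOn_of_convex
    (fun s hs => (hf s (Or.inl (ne_of_gt hs))).differentiableWithinAt) hHo hHc
  have hNe : Complex.IsExactOn f N := DifferentiableOn.isExactOn_of_convex
    (fun s hs => (hf s (Or.inl (ne_of_lt hs))).differentiableWithinAt) hNo hNc
  have hm1 : a < (a + b) / 2 := by linarith
  have hm2 : (a + b) / 2 < b := by linarith
  have h1 := hSe.union hHe hSo hHo (hSc.inter hHc).isPreconnected
    ⟨⟨(a + b) / 2, 1⟩, ⟨hm1, hm2⟩, one_pos (α := ℝ)⟩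
  have hint : (S ∪ H) ∩ N = S ∩ N := by
    ext s
    simp only [hH, hN, Set.mem_inter_iff, Set.mem_union, Set.mem_ofPred_eq]
    refine ⟨fun h => ⟨h.1.resolve_right (by linarith [h.2]), h.2⟩, fun h => ⟨Or.inl h.1, h.2⟩⟩
  have h2 := h1.union hNe (hSo.union hHo) hNo (by rw [hint]; exact (hSc.inter hNc).isPreconnected)
    (by rw [hint]; exact ⟨⟨(a + b) / 2, -1⟩, ⟨hm1, hm2⟩, neg_one_lt_zero (R := ℝ)⟩)
  obtain ⟨P, hP⟩ := h2
  refine ⟨P, fun s hs => hP s ?_⟩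
  rcases hs with hs | hs
  · rcases lt_or_gt_of_ne hs with h | h
    · exact Or.inr h
    · exact Or.inl (Or.inr h)
  · exact Or.inl (Or.inl hs)

/-- Integrability on the subintervals of `[0, 1]` without break points in their interior suffices;
the proof is by induction on the number of break points. -/
lemma intervalIntegrable_of_piecewise {g : ℝ → ℂ} {S : Finset ℝ}
    (h : ∀ u v : ℝ, 0 ≤ u → u < v → v ≤ 1 → (∀ p ∈ S, p ∉ Set.Ioo u v) →
      IntervalIntegrable g volume u v) : IntervalIntegrable g volume 0 1 := by
  suffices H : ∀ n : ℕ, ∀ u v : ℝ, 0 ≤ u → u < v → v ≤ 1 →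
      (S.filter (· ∈ Set.Ioo u v)).card ≤ n → IntervalIntegrable g volume u v from
    H _ 0 1 le_rfl one_pos le_rfl le_rfl
  intro n
  induction n with
  | zero =>
    intro u v hu huv hv hc
    refine h u v hu huv hv fun p hp hpm => ?_
    rw [Nat.le_zero, Finset.card_eq_zero] at hc
    exact Finset.notMem_empty p (hc ▸ Finset.mem_filter.2 ⟨hp, hpm⟩)
  | succ n ih =>
    intro u v hu huv hv hc
    by_cases hS : ∃ p ∈ S, p ∈ Set.Ioo u v
    · obtain ⟨p, hp, hpm⟩ := hS
      have hsub : ∀ u' v' : ℝ, u ≤ u' → v' ≤ v → p ∉ Set.Ioo u' v' →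
          (S.filter (· ∈ Set.Ioo u' v')).card ≤ n := by
        intro u' v' hu' hv' hp'
        refine Nat.lt_succ_iff.1 (lt_of_lt_of_le (Finset.card_lt_card ?_) hc)
        refine Finset.ssubset_iff_subset_ne.2 ⟨fun q hq => ?_, fun he => hp' ?_⟩
        · rw [Finset.mem_filter] at hq ⊢
          exact ⟨hq.1, Set.Ioo_subset_Ioo hu' hv' hq.2⟩
        · have : p ∈ S.filter (· ∈ Set.Ioo u v) := Finset.mem_filter.2 ⟨hp, hpm⟩
          rw [← he] at this
          exact (Finset.mem_filter.1 this).2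
      exact (ih u p hu hpm.1 (hpm.2.le.trans hv) (hsub u p le_rfl hpm.2.le (by simp))).trans
        (ih p v (hu.trans hpm.1.le) hpm.2 hv (hsub p v hpm.1.le le_rfl (by simp)))
    · push Not at hS
      exact h u v hu huv hv hS

/-- The fundamental theorem of calculus along a piecewise `C¹` path. -/
lemma curveIntegral_form_of_isExactOn {f P : ℂ → ℂ} {U : Set ℂ} (hf : ContinuousOn f U)
    (hP : ∀ s ∈ U, HasDerivAt P (f s) s) {a b : ℂ} (γ : Path a b) (hγU : ∀ t, γ t ∈ U)
    {S : Finset ℝ} (hγ : ∀ u v : ℝ, 0 ≤ u → u < v → v ≤ 1 →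
      (∀ p ∈ S, p ∉ Set.Ioo u v) → ContDiffOn ℝ 1 γ.extend (Set.Icc u v)) :
    CurveIntegrable (LeRoy.LeftLoop.form f) γ ∧
      curveIntegral (LeRoy.LeftLoop.form f) γ = P b - P a := by
  have hmem : ∀ t, γ.extend t ∈ U := fun t => by
    have := Set.mem_range_self (f := γ.extend) t
    rw [Path.extend_range] at this
    obtain ⟨u, hu⟩ := this
    rw [← hu]
    exact hγU u
  have hfc : Continuous fun t => f (γ.extend t) := hf.comp_continuous γ.continuous_extend hmem
  have hfun : ∀ t, curveIntegralFun (LeRoy.LeftLoop.form f) γ t =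
      derivWithin γ.extend unitInterval t * f (γ.extend t) := fun t => by
    rw [curveIntegralFun_def, LeRoy.LeftLoop.form, ContinuousLinearMap.toSpanSingleton_apply,
      smul_eq_mul]
  have hnhds : ∀ t ∈ Set.Ioo (0 : ℝ) 1, unitInterval ∈ nhds t := fun t ht =>
    Icc_mem_nhds ht.1 ht.2
  have hint : CurveIntegrable (LeRoy.LeftLoop.form f) γ := by
    refine intervalIntegrable_of_piecewise (S := S) fun u v hu huv hv hS => ?_
    have hc := hγ u v hu huv hv hS
    have hcont : ContinuousOn
        (fun t => derivWithin γ.extend (Set.Icc u v) t * f (γ.extend t)) (Set.uIcc u v) := by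
      rw [Set.uIcc_of_le huv.le]
      exact (hc.continuousOn_derivWithin (uniqueDiffOn_Icc huv) le_rfl).mul hfc.continuousOn
    refine hcont.intervalIntegrable.congr_uIoo ?_
    rw [Set.uIoo_of_le huv.le]
    intro t ht
    have ht' : t ∈ Set.Ioo (0 : ℝ) 1 := ⟨hu.trans_lt ht.1, ht.2.trans_le hv⟩
    simp only [hfun]
    rw [derivWithin_of_mem_nhds (Icc_mem_nhds ht.1 ht.2), derivWithin_of_mem_nhds (hnhds t ht')]
  refine ⟨hint, ?_⟩
  have hPc : ContinuousOn P U := fun s hs => (hP s hs).continuousAt.continuousWithinAt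
  have hder : ∀ t ∈ Set.Ioo (0 : ℝ) 1 \ (S : Set ℝ), HasDerivAt (fun t => P (γ.extend t))
      (curveIntegralFun (LeRoy.LeftLoop.form f) γ t) t := by
    rintro t ⟨ht, htS⟩
    -- a neighbourhood of `t` in `(0, 1)` contains no break point
    have hopen : Set.Ioo (0 : ℝ) 1 ∩ (S : Set ℝ)ᶜ ∈ nhds t :=
      (isOpen_Ioo.inter S.finite_toSet.isClosed.isOpen_compl).mem_nhds ⟨ht, htS⟩
    obtain ⟨ε, hε, hball⟩ := Metric.mem_nhds_iff.1 hopen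
    rw [Real.ball_eq_Ioo] at hball
    have hin : ∀ x, t - ε < x → x < t + ε → (0 < x ∧ x < 1) ∧ x ∉ (S : Set ℝ) :=
      fun x h1 h2 => hball ⟨h1, h2⟩
    have hu := hin (t - ε / 2) (by linarith) (by linarith)
    have hv := hin (t + ε / 2) (by linarith) (by linarith)
    have hc := hγ (t - ε / 2) (t + ε / 2) hu.1.1.le (by linarith) hv.1.2.le
      fun p hp hpm => (hin p (by linarith [hpm.1]) (by linarith [hpm.2])).2 hp
    have hd : DifferentiableAt ℝ γ.extend t :=
      (hc.differentiableOn one_ne_zero).differentiableAt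
        (Icc_mem_nhds (by linarith) (by linarith))
    rw [hfun, derivWithin_of_mem_nhds (hnhds t ht), mul_comm]
    have := (hP _ (hmem t)).scomp t hd.hasDerivAt
    simpa [mul_comm, Function.comp_def] using this
  have := integral_eq_of_hasDerivAt_off_countable_of_le (fun t => P (γ.extend t))
    (curveIntegralFun (LeRoy.LeftLoop.form f) γ) zero_le_one S.countable_toSet
    (hPc.comp_continuous γ.continuous_extend hmem).continuousOn hder hint
  rw [curveIntegral_def, this]
  simp

lemma hasDerivAt_complex_mk_left (x y : ℝ) : HasDerivAt (fun x : ℝ => (⟨x, y⟩ : ℂ)) 1 x := by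
  simp only [Complex.mk_eq_add_mul_I]
  exact (Complex.ofRealCLM.hasDerivAt (x := x)).add_const (y * Complex.I)

lemma hasDerivAt_complex_mk_right (x y : ℝ) :
    HasDerivAt (fun y : ℝ => (⟨x, y⟩ : ℂ)) Complex.I y := by
  simp only [Complex.mk_eq_add_mul_I]
  simpa using ((Complex.ofRealCLM.hasDerivAt (x := y)).mul_const Complex.I).const_add (x : ℂ)

lemma integral_horizontal_eq_sub {f P : ℂ → ℂ} {a b y : ℝ}
    (hP : ∀ x ∈ Set.uIcc a b, HasDerivAt P (f ⟨x, y⟩) ⟨x, y⟩)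
    (hf : ∀ x ∈ Set.uIcc a b, ContinuousAt f ⟨x, y⟩) :
    ∫ x in a..b, f ⟨x, y⟩ = P ⟨b, y⟩ - P ⟨a, y⟩ := by
  refine intervalIntegral.integral_eq_sub_of_hasDerivAt (f := fun x : ℝ => P ⟨x, y⟩)
    (fun x hx => ?_) (ContinuousOn.intervalIntegrable fun x hx => ?_)
  · exact (HasDerivAt.comp (h := fun x : ℝ => (⟨x, y⟩ : ℂ)) x (hP x hx)
      (hasDerivAt_complex_mk_left x y)).congr_deriv
      (mul_one _)
  · exact (ContinuousAt.comp (f := fun x : ℝ => (⟨x, y⟩ : ℂ)) (hf x hx)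
      (hasDerivAt_complex_mk_left x y).continuousAt).continuousWithinAt

lemma integral_vertical_eq_sub {f P : ℂ → ℂ} {a b x : ℝ}
    (hP : ∀ y ∈ Set.uIcc a b, HasDerivAt P (f ⟨x, y⟩) ⟨x, y⟩)
    (hf : ∀ y ∈ Set.uIcc a b, ContinuousAt f ⟨x, y⟩) :
    Complex.I * ∫ y in a..b, f ⟨x, y⟩ = P ⟨x, b⟩ - P ⟨x, a⟩ := by
  rw [← intervalIntegral.integral_const_mul]
  refine intervalIntegral.integral_eq_sub_of_hasDerivAt (f := fun y : ℝ => P ⟨x, y⟩)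
    (fun y hy => ?_) (ContinuousOn.intervalIntegrable fun y hy => ?_)
  · exact (HasDerivAt.comp (h := fun y : ℝ => (⟨x, y⟩ : ℂ)) y (hP y hy)
      (hasDerivAt_complex_mk_right x y)).congr_deriv
      (mul_comm _ _)
  · exact ((ContinuousAt.comp (f := fun y : ℝ => (⟨x, y⟩ : ℂ)) (hf y hy)
      (hasDerivAt_complex_mk_right x y).continuousAt).const_mul _).continuousWithinAt

/-! ### Cauchy's formula on a rectangle -/

/-- The integral of `f(s) ds` along the boundary of `[a, b] × [c, d]`, run through
counterclockwise. -/
def rectIntegral (f : ℂ → ℂ) (a b c d : ℝ) : ℂ :=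
  (∫ x in a..b, f ⟨x, c⟩) - (∫ x in a..b, f ⟨x, d⟩) + Complex.I * (∫ y in c..d, f ⟨b, y⟩) -
    Complex.I * ∫ y in c..d, f ⟨a, y⟩

lemma rectIntegral_eq_zero {f : ℂ → ℂ} {a b c d : ℝ} (hab : a ≤ b) (hcd : c ≤ d)
    (hf : DifferentiableOn ℂ f (Set.Icc a b ×ℂ Set.Icc c d)) : rectIntegral f a b c d = 0 := by
  have := Complex.integral_boundary_rect_eq_zero_of_differentiableOn f ⟨a, c⟩ ⟨b, d⟩
    (by simpa only [Set.uIcc_of_le hab, Set.uIcc_of_le hcd] using hf)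
  simpa only [rectIntegral, ← Complex.mk_eq_add_mul_I, smul_eq_mul] using this

/-- Three sides of the boundary lie in the domain of the branch `s ↦ log (-s)` of the logarithm and
the fourth lies in that of the principal branch. -/
lemma rectIntegral_inv {a b c d : ℝ} (ha : a < 0) (hb : 0 < b) (hc : c < 0) (hd : 0 < d) :
    rectIntegral (fun s => s⁻¹) a b c d = 2 * Real.pi * Complex.I := by
  have hlog : ∀ s : ℂ, 0 < s.re → HasDerivAt Complex.log s⁻¹ s := fun s hs =>
    Complex.hasDerivAt_log (Or.inl hs)
  have hlogneg : ∀ s : ℂ, s.re < 0 ∨ s.im ≠ 0 →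
      HasDerivAt (fun s => Complex.log (-s)) s⁻¹ s := fun s hs => by
    have hs' : -s ∈ Complex.slitPlane := by
      rw [Complex.mem_slitPlane_iff]; simpa using hs
    simpa [inv_neg] using (hasDerivAt_neg s).clog hs'
  have hcts : ∀ s : ℂ, s ≠ 0 → ContinuousAt (fun s : ℂ => s⁻¹) s := fun s hs => continuousAt_inv₀ hs
  have hne : ∀ s : ℂ, s.re ≠ 0 ∨ s.im ≠ 0 → s ≠ 0 := fun s hs h => by simp [h] at hs
  rw [rectIntegral,
    integral_horizontal_eq_sub (f := fun s => s⁻¹) (P := fun s => Complex.log (-s))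
      (fun x _ => hlogneg _ (Or.inr hc.ne)) (fun x _ => hcts _ (hne _ (Or.inr hc.ne))),
    integral_horizontal_eq_sub (f := fun s => s⁻¹) (P := fun s => Complex.log (-s))
      (fun x _ => hlogneg _ (Or.inr hd.ne')) (fun x _ => hcts _ (hne _ (Or.inr hd.ne'))),
    integral_vertical_eq_sub (f := fun s => s⁻¹) (P := Complex.log)
      (fun y _ => hlog _ hb) (fun y _ => hcts _ (hne _ (Or.inl hb.ne'))),
    integral_vertical_eq_sub (f := fun s => s⁻¹) (P := fun s => Complex.log (-s))
      (fun y _ => hlogneg _ (Or.inl ha)) (fun y _ => hcts _ (hne _ (Or.inl ha.ne)))]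
  have h1 : Complex.log (-⟨b, d⟩) = Complex.log ⟨b, d⟩ - Real.pi * Complex.I := by
    rw [Complex.log, Complex.log, norm_neg, Complex.arg_neg_eq_arg_sub_pi_of_im_pos (by simpa)]
    push_cast; ring
  have h2 : Complex.log (-⟨b, c⟩) = Complex.log ⟨b, c⟩ + Real.pi * Complex.I := by
    rw [Complex.log, Complex.log, norm_neg, Complex.arg_neg_eq_arg_add_pi_of_im_neg (by simpa)]
    push_cast; ring
  rw [h1, h2]
  ring

lemma rectIntegral_comp_sub {f : ℂ → ℂ} (a b c d p : ℝ) :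
    rectIntegral (fun s => f (s - p)) a b c d = rectIntegral f (a - p) (b - p) c d := by
  have hsub : ∀ x y : ℝ, (⟨x, y⟩ : ℂ) - p = ⟨x - p, y⟩ := fun x y => by
    apply Complex.ext <;> simp
  simp only [rectIntegral, hsub]
  rw [← intervalIntegral.integral_comp_sub_right (fun x => f ⟨x, c⟩),
    ← intervalIntegral.integral_comp_sub_right (fun x => f ⟨x, d⟩)]

lemma rectIntegral_congr {f g : ℂ → ℂ} {a b c d : ℝ}
    (h : ∀ s : ℂ, s.re = a ∨ s.re = b ∨ s.im = c ∨ s.im = d → f s = g s) :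
    rectIntegral f a b c d = rectIntegral g a b c d := by
  have h1 : ∀ y : ℝ, f ⟨a, y⟩ = g ⟨a, y⟩ := fun y => h _ (Or.inl rfl)
  have h2 : ∀ y : ℝ, f ⟨b, y⟩ = g ⟨b, y⟩ := fun y => h _ (Or.inr (Or.inl rfl))
  have h3 : ∀ x : ℝ, f ⟨x, c⟩ = g ⟨x, c⟩ := fun x => h _ (Or.inr (Or.inr (Or.inl rfl)))
  have h4 : ∀ x : ℝ, f ⟨x, d⟩ = g ⟨x, d⟩ := fun x => h _ (Or.inr (Or.inr (Or.inr rfl)))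
  simp only [rectIntegral, h1, h2, h3, h4]

lemma rectIntegral_add {f g : ℂ → ℂ} {a b c d : ℝ} (hab : a ≤ b) (hcd : c ≤ d)
    (hf : ContinuousOn f (Set.Icc a b ×ℂ Set.Icc c d \ Set.Ioo a b ×ℂ Set.Ioo c d))
    (hg : ContinuousOn g (Set.Icc a b ×ℂ Set.Icc c d \ Set.Ioo a b ×ℂ Set.Ioo c d)) :
    rectIntegral (fun s => f s + g s) a b c d = rectIntegral f a b c d + rectIntegral g a b c d := by
  have hH : ∀ {h : ℂ → ℂ} {y : ℝ},
      ContinuousOn h (Set.Icc a b ×ℂ Set.Icc c d \ Set.Ioo a b ×ℂ Set.Ioo c d) →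
      y ∈ Set.Icc c d → y ∉ Set.Ioo c d →
      IntervalIntegrable (fun x : ℝ => h ⟨x, y⟩) volume a b := fun {h y} hh hy hy' => by
    refine ContinuousOn.intervalIntegrable (hh.comp ?_ fun x hx => ?_)
    · exact fun x _ => (hasDerivAt_complex_mk_left x y).continuousAt.continuousWithinAt
    · rw [Set.uIcc_of_le hab] at hx
      exact ⟨⟨hx, hy⟩, fun h => hy' h.2⟩
  have hV : ∀ {h : ℂ → ℂ} {x : ℝ},
      ContinuousOn h (Set.Icc a b ×ℂ Set.Icc c d \ Set.Ioo a b ×ℂ Set.Ioo c d) →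
      x ∈ Set.Icc a b → x ∉ Set.Ioo a b →
      IntervalIntegrable (fun y : ℝ => h ⟨x, y⟩) volume c d := fun {h x} hh hx hx' => by
    refine ContinuousOn.intervalIntegrable (hh.comp ?_ fun y hy => ?_)
    · exact fun y _ => (hasDerivAt_complex_mk_right x y).continuousAt.continuousWithinAt
    · rw [Set.uIcc_of_le hcd] at hy
      exact ⟨⟨hx, hy⟩, fun h => hx' h.1⟩
  have hc : c ∈ Set.Icc c d := ⟨le_rfl, hcd⟩
  have hd : d ∈ Set.Icc c d := ⟨hcd, le_rfl⟩
  have ha : a ∈ Set.Icc a b := ⟨le_rfl, hab⟩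
  have hb : b ∈ Set.Icc a b := ⟨hab, le_rfl⟩
  simp only [rectIntegral]
  rw [intervalIntegral.integral_add (hH hf hc (by simp)) (hH hg hc (by simp)),
    intervalIntegral.integral_add (hH hf hd (by simp)) (hH hg hd (by simp)),
    intervalIntegral.integral_add (hV hf ha (by simp)) (hV hg ha (by simp)),
    intervalIntegral.integral_add (hV hf hb (by simp)) (hV hg hb (by simp))]
  ring

lemma rectIntegral_const_mul (r : ℂ) (f : ℂ → ℂ) (a b c d : ℝ) :
    rectIntegral (fun s => r * f s) a b c d = r * rectIntegral f a b c d := by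
  simp only [rectIntegral, intervalIntegral.integral_const_mul]
  ring

/-- Cauchy's integral formula on a rectangle, at a point of the real axis. -/
lemma rectIntegral_div_sub {u : ℂ → ℂ} {a b c d p : ℝ} (hap : a < p) (hpb : p < b) (hc : c < 0)
    (hd : 0 < d) (hu : DifferentiableOn ℂ u (Set.Icc a b ×ℂ Set.Icc c d)) :
    rectIntegral (fun s => u s / (s - p)) a b c d = 2 * Real.pi * Complex.I * u p := by
  have hnhds : Set.Icc a b ×ℂ Set.Icc c d ∈ nhds (p : ℂ) := by
    have : Set.Ioo a b ×ℂ Set.Ioo c d ∈ nhds (p : ℂ) :=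
      (isOpen_Ioo.reProdIm isOpen_Ioo).mem_nhds ⟨⟨by simpa, by simpa⟩, by simpa, by simpa⟩
    exact Filter.mem_of_superset this fun s hs =>
      ⟨Set.Ioo_subset_Icc_self hs.1, Set.Ioo_subset_Icc_self hs.2⟩
  have hD := (Complex.differentiableOn_dslope hnhds).2 hu
  have hne : ∀ s : ℂ, s ∉ Set.Ioo a b ×ℂ Set.Ioo c d → s ≠ p := by
    rintro s hs rfl
    exact hs ⟨⟨by simpa, by simpa⟩, by simpa, by simpa⟩
  have hsplit : rectIntegral (fun s => u s / (s - p)) a b c d =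
      rectIntegral (fun s => dslope u p s + u p * (s - p)⁻¹) a b c d := by
    refine rectIntegral_congr fun s hs => ?_
    have hsp : s ≠ p := hne s fun h => by
      rcases hs with hs | hs | hs | hs
      · exact absurd h.1.1 (by simp [hs])
      · exact absurd h.1.2 (by simp [hs])
      · exact absurd h.2.1 (by simp [hs])
      · exact absurd h.2.2 (by simp [hs])
    rw [dslope_of_ne _ hsp, slope_def_field]
    ring
  rw [hsplit, rectIntegral_add (hap.trans hpb).le (hc.trans hd).le
    (hD.continuousOn.mono Set.sdiff_subset), rectIntegral_eq_zero (hap.trans hpb).le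
    (hc.trans hd).le hD, rectIntegral_const_mul, rectIntegral_comp_sub (f := fun s => s⁻¹),
    rectIntegral_inv (by linarith) (by linarith) hc hd]
  · ring
  · intro s hs
    have : s - p ≠ 0 := sub_ne_zero.2 (hne s hs.2)
    exact ContinuousAt.continuousWithinAt (by fun_prop (disch := assumption))

/-! ### Residues and convergence -/

namespace LeRoy

lemma negPow_neg_nat {z : ℂ} (hz : z ≠ 0) {θ : ℝ}
    (hθ : (‖z‖ : ℂ) * Complex.exp (Complex.I * θ) = -z) (m : ℕ) :
    negPow z θ (-m) = (-1) ^ m * (1 / z) ^ m := by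
  have h : Complex.exp (Real.log ‖z‖ + Complex.I * θ) = -z := by
    rw [Complex.exp_add, ← Complex.ofReal_exp, Real.exp_log (norm_pos_iff.2 hz), hθ]
  rw [negPow, neg_mul, Complex.exp_neg, Complex.exp_nat_mul, h, ← inv_pow, ← mul_pow, inv_neg,
    one_div, neg_one_mul]

lemma regularPart_neg_nat {α β : ℝ} (γ : ℝ) (hα : 0 < α) (hβ : 0 < β) {z : ℂ} (hz : z ≠ 0) {θ : ℝ}
    (hθ : (‖z‖ : ℂ) * Complex.exp (Complex.I * θ) = -z) (m : ℕ) :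
    regularPart α β γ z θ (-m) =
      (-1) ^ m * ((1 / z) ^ m / (((Real.Gamma (α * m + β)) ^ γ : ℝ) : ℂ)) := by
  have h := gammaPow_ofReal (α := α) (β := β) (γ := γ) (x := -m) (by
    rw [neg_mul_neg]
    positivity)
  rw [neg_mul_neg, Complex.ofReal_neg, Complex.ofReal_natCast] at h
  rw [regularPart, negPow_neg_nat hz hθ, h, mul_div_assoc]

lemma summable_leRoy {α β γ : ℝ} (hα : 0 < α) (hβ : 0 < β) (hγ : 0 < γ) {z : ℂ} (hz : z ≠ 0)
    {θ : ℝ} (hθ : (‖z‖ : ℂ) * Complex.exp (Complex.I * θ) = -z) :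
    Summable (fun k : ℕ => (1 / z) ^ k / (((Real.Gamma (α * k + β)) ^ γ : ℝ) : ℂ)) := by
  obtain ⟨M, -, h⟩ := exists_norm_regularPart_le hα hβ hγ z θ 0
  rw [← summable_nat_add_iff 1]
  refine Summable.of_norm_bounded
    (((summable_nat_add_iff 1).2 Real.summable_exp_neg_nat).mul_left M) fun k => ?_
  have h1 := h (-((k + 1 : ℕ) : ℂ)) (by
    rw [Complex.neg_re, Complex.natCast_re]
    exact neg_lt_zero.2 (by positivity)) (by simp)
  rw [regularPart_neg_nat γ hα hβ hz hθ, norm_mul, norm_pow, norm_neg, norm_one, one_pow, one_mul,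
    Complex.neg_re, Complex.natCast_re] at h1
  exact h1

/-- The residue of the integrand at `-(k + 1)`, computed over a rectangle of width one. -/
lemma rectIntegral_integrand {α β : ℝ} (γ : ℝ) (hα : 0 < α) (hβ : 0 < β) {z : ℂ} (hz : z ≠ 0)
    {θ : ℝ} (hθ : (‖z‖ : ℂ) * Complex.exp (Complex.I * θ) = -z) {c d : ℝ} (hc : c < 0)
    (hd : 0 < d) (k : ℕ) :
    rectIntegral (integrand α β γ z θ) (-(k + 1 : ℕ) - 1 / 2) (-k - 1 / 2) c d =
      -(2 * Real.pi * Complex.I) *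
        ((1 / z) ^ (k + 1) / (((Real.Gamma (α * (k + 1 : ℕ) + β)) ^ γ : ℝ) : ℂ)) := by
  set m := k + 1 with hm
  set p : ℝ := -m with hp
  have hpc : (p : ℂ) = -(m : ℂ) := by simp [hp]
  have hpi : (Real.pi : ℂ) ≠ 0 := by exact_mod_cast Real.pi_ne_zero
  have hmk : (m : ℝ) = k + 1 := by simp [hm]
  -- `sin (π s) = (s - p) q(s)` with `q` entire and zero-free on the rectangle
  set q : ℂ → ℂ := dslope (fun s => Complex.sin (Real.pi * s)) p with hq
  have hsinp : Complex.sin (Real.pi * p) = 0 := by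
    rw [hpc, mul_neg, Complex.sin_neg, mul_comm, Complex.sin_nat_mul_pi, neg_zero]
  have hqd : Differentiable ℂ q := by
    rw [← differentiableOn_univ, hq, Complex.differentiableOn_dslope Filter.univ_mem]
    exact Differentiable.differentiableOn (by fun_prop)
  have hqne : ∀ s : ℂ, s ≠ p → q s = Complex.sin (Real.pi * s) / (s - p) := fun s hs => by
    rw [hq, dslope_of_ne _ hs, slope_def_field, hsinp, sub_zero]
  have hqp : q p = Real.pi * (-1) ^ m := by
    have h1 : HasDerivAt (fun s : ℂ => Complex.sin (Real.pi * s))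
        (Complex.cos (Real.pi * p) * (Real.pi * 1)) p :=
      ((hasDerivAt_id (p : ℂ)).const_mul (Real.pi : ℂ)).csin
    have h2 : Complex.cos (Real.pi * p) = (-1) ^ m := by
      rw [hpc, mul_neg, Complex.cos_neg, mul_comm]
      have := Real.cos_nat_mul_pi m
      exact_mod_cast congrArg (fun x : ℝ => (x : ℂ)) this
    rw [hq, dslope_same, h1.deriv, h2]
    ring
  have hq0 : ∀ s ∈ Set.Icc (-(m : ℝ) - 1 / 2) (-k - 1 / 2) ×ℂ Set.Icc c d, q s ≠ 0 := by
    rintro s ⟨⟨h1, h2⟩, -⟩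
    by_cases hs : s = p
    · rw [hs, hqp]
      exact mul_ne_zero hpi (pow_ne_zero _ (by simp))
    · rw [hqne s hs]
      refine div_ne_zero (sin_pi_mul_ne_zero ?_) (sub_ne_zero.2 hs)
      by_contra! hcon
      obtain ⟨him, hcon⟩ := hcon
      have hre : s.re ≠ p := fun h => hs (Complex.ext (by simpa using h) (by simpa using him))
      rcases lt_or_gt_of_ne hre with h | h
      · have := hcon (-m - 1) (by push_cast; linarith)
        push_cast at this
        linarith
      · have := hcon (-m) (by push_cast; linarith)
        push_cast at this
        linarith
  set u : ℂ → ℂ := fun s => -(Real.pi * regularPart α β γ z θ s / q s) with hu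
  have hud : DifferentiableOn ℂ u (Set.Icc (-(m : ℝ) - 1 / 2) (-k - 1 / 2) ×ℂ Set.Icc c d) :=
    fun s hs => by
      have hre : s.re < 0 := by
        have : s.re ≤ -k - 1 / 2 := hs.1.2
        linarith [(Nat.cast_nonneg k : (0 : ℝ) ≤ k)]
      exact ((((differentiableAt_regularPart hα hβ z θ (Or.inr hre)).const_mul _).div
        (hqd s) (hq0 s hs)).neg).differentiableWithinAt
  have hcongr : rectIntegral (integrand α β γ z θ) (-(m : ℝ) - 1 / 2) (-k - 1 / 2) c d =
      rectIntegral (fun s => u s / (s - p)) (-(m : ℝ) - 1 / 2) (-k - 1 / 2) c d := by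
    refine rectIntegral_congr fun s hs => ?_
    have hsp : s ≠ p := by
      rintro rfl
      rw [Complex.ofReal_re, Complex.ofReal_im] at hs
      rcases hs with hs | hs | hs | hs <;> linarith
    have h0 : s - p ≠ 0 := sub_ne_zero.2 hsp
    simp only [hu]
    rw [integrand_eq, hqne s hsp]
    field_simp
  rw [hcongr, rectIntegral_div_sub (by linarith) (by linarith) hc hd hud]
  simp only [hu]
  rw [hqp, hpc, regularPart_neg_nat γ hα hβ hz hθ]
  field_simp

/-! ### Loops with a vertical crossing -/

/-- The integral of `f(s) ds` over the loop that comes from `-∞ + i c`, crosses the strip along the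
vertical segment with real part `a`, and goes to `-∞ + i d`. -/
def hookIntegral (f : ℂ → ℂ) (c d a : ℝ) : ℂ :=
  (∫ x in Set.Iic a, f ⟨x, c⟩) + Complex.I * (∫ y in c..d, f ⟨a, y⟩) - ∫ x in Set.Iic a, f ⟨x, d⟩

lemma hookIntegral_sub {f : ℂ → ℂ} {c d : ℝ}
    (hc : ∀ a, IntegrableOn (fun x : ℝ => f ⟨x, c⟩) (Set.Iic a))
    (hd : ∀ a, IntegrableOn (fun x : ℝ => f ⟨x, d⟩) (Set.Iic a)) (a b : ℝ) :
    hookIntegral f c d b - hookIntegral f c d a = rectIntegral f a b c d := by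
  rw [rectIntegral, ← intervalIntegral.integral_Iic_sub_Iic (hc a) (hc b),
    ← intervalIntegral.integral_Iic_sub_Iic (hd a) (hd b), hookIntegral, hookIntegral]
  ring

lemma integrableOn_integrand_horizontal {α β γ : ℝ} (hα : 0 < α) (hβ : 0 < β) (hγ : 0 < γ)
    (z : ℂ) (θ : ℝ) {φ : ℝ} (hφ : φ ≠ 0) (a : ℝ) :
    IntegrableOn (fun x : ℝ => integrand α β γ z θ ⟨x, φ⟩) (Set.Iic a) := by
  have hcont : Continuous fun x : ℝ => integrand α β γ z θ ⟨x, φ⟩ :=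
    continuous_iff_continuousAt.2 fun x =>
      ContinuousAt.comp (f := fun x : ℝ => (⟨x, φ⟩ : ℂ))
        (differentiableAt_integrand hα hβ z θ (Or.inl hφ)).continuousAt
        (hasDerivAt_complex_mk_left x φ).continuousAt
  obtain ⟨M, hM⟩ := exists_norm_integrand_horizontal_le hα hβ hγ z θ hφ
  have h1 : IntegrableOn (fun x : ℝ => integrand α β γ z θ ⟨x, φ⟩) (Set.Iic (-1)) := by
    refine ((integrableOn_exp_Iic (-1)).const_mul M).mono' hcont.aestronglyMeasurable ?_
    filter_upwards [ae_restrict_mem measurableSet_Iic] with x hx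
    exact hM x (lt_of_le_of_lt hx (by norm_num))
  have h2 := h1.union (hcont.integrableOn_Icc (a := -1) (b := a))
  refine h2.mono_set fun x hx => ?_
  rcases le_total x (-1) with h | h
  · exact Or.inl h
  · exact Or.inr ⟨h, hx⟩

lemma norm_setIntegral_Iic_le {g : ℝ → ℂ} {M a : ℝ} (ha : a < 0)
    (hg : ∀ x : ℝ, x < 0 → ‖g x‖ ≤ M * Real.exp x) : ‖∫ x in Set.Iic a, g x‖ ≤ M * Real.exp a := by
  rw [← integral_exp_Iic a, ← integral_const_mul]
  refine norm_integral_le_of_norm_le ((integrableOn_exp_Iic a).const_mul M) ?_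
  filter_upwards [ae_restrict_mem measurableSet_Iic] with x hx
  exact hg x (lt_of_le_of_lt hx ha)

lemma tendsto_hookIntegral_integrand {α β γ : ℝ} (hα : 0 < α) (hβ : 0 < β) (hγ : 0 < γ)
    (z : ℂ) (θ : ℝ) {c d : ℝ} (hc : c < 0) (hd : 0 < d) :
    Filter.Tendsto (fun k : ℕ => hookIntegral (integrand α β γ z θ) c d (-k - 1 / 2))
      Filter.atTop (nhds 0) := by
  obtain ⟨M₁, h₁⟩ := exists_norm_integrand_horizontal_le hα hβ hγ z θ hc.ne
  obtain ⟨M₂, h₂⟩ := exists_norm_integrand_horizontal_le hα hβ hγ z θ hd.ne'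
  obtain ⟨M₃, h₃⟩ := exists_norm_integrand_vertical_le hα hβ hγ z θ (max (-c) d)
  have hlim : Filter.Tendsto
      (fun k : ℕ => (M₁ + M₃ * |d - c| + M₂) * Real.exp (-(k : ℝ) - 1 / 2))
      Filter.atTop (nhds 0) := by
    have h1 : Filter.Tendsto (fun k : ℕ => -(k : ℝ) - 1 / 2) Filter.atTop Filter.atBot :=
      Filter.tendsto_atBot_add_const_right _ _
        (Filter.tendsto_neg_atTop_atBot.comp tendsto_natCast_atTop_atTop)
    simpa using (Real.tendsto_exp_atBot.comp h1).const_mul (M₁ + M₃ * |d - c| + M₂)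
  refine squeeze_zero_norm (fun k => ?_) hlim
  have hk : -(k : ℝ) - 1 / 2 < 0 := by linarith [(Nat.cast_nonneg k : (0 : ℝ) ≤ k)]
  have e1 := norm_setIntegral_Iic_le hk h₁
  have e2 := norm_setIntegral_Iic_le hk h₂
  have e3 : ‖Complex.I * ∫ y in c..d, integrand α β γ z θ ⟨-(k : ℝ) - 1 / 2, y⟩‖ ≤
      M₃ * Real.exp (-k - 1 / 2) * |d - c| := by
    rw [norm_mul, Complex.norm_I, one_mul]
    refine intervalIntegral.norm_integral_le_of_norm_le_const fun y hy => h₃ k y ?_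
    rw [Set.uIoc_of_le (hc.trans hd).le] at hy
    exact abs_le.2 ⟨by linarith [le_max_left (-c) d, hy.1], hy.2.trans (le_max_right _ _)⟩
  rw [hookIntegral]
  refine (norm_sub_le _ _).trans ((add_le_add (norm_add_le _ _) le_rfl).trans ?_)
  linarith

/-- Moving the crossing point of the loop to `-∞` picks up all the residues. -/
lemma hookIntegral_integrand {α β γ : ℝ} (hα : 0 < α) (hβ : 0 < β) (hγ : 0 < γ) {z : ℂ}
    (hz : z ≠ 0) {θ : ℝ} (hθ : (‖z‖ : ℂ) * Complex.exp (Complex.I * θ) = -z) {c d : ℝ} (hc : c < 0)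
    (hd : 0 < d) :
    hookIntegral (integrand α β γ z θ) c d (-1 / 2) = 2 * Real.pi * Complex.I *
      (1 / (((Real.Gamma β) ^ γ : ℝ) : ℂ) - leRoy α β γ (1 / z)) := by
  set J : ℕ → ℂ := fun k => hookIntegral (integrand α β γ z θ) c d (-k - 1 / 2) with hJ
  set A : ℕ → ℂ := fun k => (1 / z) ^ k / (((Real.Gamma (α * k + β)) ^ γ : ℝ) : ℂ) with hA
  have hs : Summable A := summable_leRoy hα hβ hγ hz hθ
  have hstep : ∀ k, J k - J (k + 1) = -(2 * Real.pi * Complex.I) * A (k + 1) := fun k => by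
    rw [hJ, hA, ← rectIntegral_integrand γ hα hβ hz hθ hc hd k]
    exact hookIntegral_sub (integrableOn_integrand_horizontal hα hβ hγ z θ hc.ne)
      (integrableOn_integrand_horizontal hα hβ hγ z θ hd.ne') _ _
  have hsum : ∀ n, J 0 - J n =
      -(2 * Real.pi * Complex.I) * ∑ k ∈ Finset.range n, A (k + 1) := fun n => by
    rw [← Finset.sum_range_sub' J n, Finset.mul_sum]
    exact Finset.sum_congr rfl fun k _ => hstep k
  have hl1 : Filter.Tendsto (fun n => J 0 - J n) Filter.atTop (nhds (J 0 - 0)) :=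
    tendsto_const_nhds.sub (tendsto_hookIntegral_integrand hα hβ hγ z θ hc hd)
  have hl2 := (((summable_nat_add_iff 1).2 hs).hasSum.tendsto_sum_nat).const_mul
    (-(2 * Real.pi * Complex.I))
  have h := tendsto_nhds_unique hl1 (hl2.congr fun n => (hsum n).symm)
  have hJ0 : J 0 = hookIntegral (integrand α β γ z θ) c d (-1 / 2) := by
    simp only [hJ]
    congr 1
    norm_num
  have hA0 : A 0 = 1 / (((Real.Gamma β) ^ γ : ℝ) : ℂ) := by simp [hA]
  have htsum : leRoy α β γ (1 / z) = A 0 + ∑' k, A (k + 1) := hs.tsum_eq_zero_add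
  rw [← hJ0, htsum, ← hA0, ← sub_zero (J 0), h]
  ring

/-- The arc of a loop stays in the plane cut along `(-∞, -1]` and `[0, ∞)`, where the integrand has
a primitive, so it may be replaced by a vertical crossing. -/
lemma contourIntegral_eq_hookIntegral {f : ℂ → ℂ} (L : LeftLoop)
    (hf : ∀ s : ℂ, s.im ≠ 0 ∨ -1 < s.re ∧ s.re < 0 → DifferentiableAt ℂ f s)
    (h₁ : ∀ a, IntegrableOn (fun x : ℝ => f ⟨x, L.φ₁⟩) (Set.Iic a))
    (h₂ : ∀ a, IntegrableOn (fun x : ℝ => f ⟨x, L.φ₂⟩) (Set.Iic a)) :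
    L.ContourIntegrable f ∧ L.contourIntegral f = hookIntegral f L.φ₁ L.φ₂ (-1 / 2) := by
  obtain ⟨P, hP⟩ := isExactOn_of_differentiableAt_off_rays neg_one_lt_zero hf
  obtain ⟨S, hS⟩ := L.piecewise_C1
  have harc : ∀ t, L.arc t ∈ {s : ℂ | s.im ≠ 0 ∨ -1 < s.re ∧ s.re < 0} := fun t => by
    by_cases h : (L.arc t).im = 0
    · rw [L.eq_c_of_im_eq_zero t h]
      exact Or.inr (by simpa using L.c_mem)
    · exact Or.inl h
  obtain ⟨hint, heq⟩ := curveIntegral_form_of_isExactOn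
    (fun s hs => (hf s hs).continuousAt.continuousWithinAt) hP L.arc harc hS
  refine ⟨⟨h₁ _, hint, h₂ _⟩, ?_⟩
  have hφ₁ : ∀ x : ℝ, (⟨x, L.φ₁⟩ : ℂ).im ≠ 0 ∨ -1 < x ∧ x < 0 := fun x => Or.inl L.φ₁_neg.ne
  have hφ₂ : ∀ x : ℝ, (⟨x, L.φ₂⟩ : ℂ).im ≠ 0 ∨ -1 < x ∧ x < 0 := fun x => Or.inl L.φ₂_pos.ne'
  have hv : ∀ y : ℝ, (⟨-1 / 2, y⟩ : ℂ).im ≠ 0 ∨ -1 < (-1 / 2 : ℝ) ∧ (-1 / 2 : ℝ) < 0 :=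
    fun y => Or.inr ⟨by norm_num, by norm_num⟩
  have e1 := integral_horizontal_eq_sub (a := -1 / 2) (b := L.x₁) (fun x _ => hP _ (hφ₁ x))
    (fun x _ => (hf _ (hφ₁ x)).continuousAt)
  have e2 := integral_horizontal_eq_sub (a := -1 / 2) (b := L.x₂) (fun x _ => hP _ (hφ₂ x))
    (fun x _ => (hf _ (hφ₂ x)).continuousAt)
  have e3 := integral_vertical_eq_sub (a := L.φ₁) (b := L.φ₂) (fun y _ => hP _ (hv y))
    (fun y _ => (hf _ (hv y)).continuousAt)
  rw [← intervalIntegral.integral_Iic_sub_Iic (h₁ _) (h₁ _)] at e1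
  rw [← intervalIntegral.integral_Iic_sub_Iic (h₂ _) (h₂ _)] at e2
  rw [LeftLoop.contourIntegral, hookIntegral, heq, e3]
  linear_combination e1 - e2

end LeRoy

end

theorem mainTheorem12 (α β γ : ℝ) (hα : 0 < α) (hβ : 0 < β) (hγ : 0 < γ)
    (L : LeRoy.LeftLoop) (z : ℂ) (hz : z ≠ 0)
    (θ : ℝ) (hθ : (‖z‖ : ℂ) * Complex.exp (Complex.I * θ) = -z) :
    L.ContourIntegrable (LeRoy.integrand α β γ z θ) ∧
    Summable (fun k : ℕ => (1 / z) ^ k / (((Real.Gamma (α * k + β)) ^ γ : ℝ) : ℂ)) ∧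
    LeRoy.leRoyExt α β γ L θ z
      = 1 / (((Real.Gamma β) ^ γ : ℝ) : ℂ) - LeRoy.leRoy α β γ (1 / z) := by
  obtain ⟨hint, heq⟩ := LeRoy.contourIntegral_eq_hookIntegral L
    (fun s hs => LeRoy.differentiableAt_integrand hα hβ z θ hs)
    (LeRoy.integrableOn_integrand_horizontal hα hβ hγ z θ L.φ₁_neg.ne)
    (LeRoy.integrableOn_integrand_horizontal hα hβ hγ z θ L.φ₂_pos.ne')
  refine ⟨hint, LeRoy.summable_leRoy hα hβ hγ hz hθ, ?_⟩
  rw [LeRoy.leRoyExt, heq, LeRoy.hookIntegral_integrand hα hβ hγ hz hθ L.φ₁_neg L.φ₂_pos,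
    inv_mul_cancel_left₀ Complex.two_pi_I_ne_zero]
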